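/- Let $\mathcal{R}$ be a linear term rewrite system (TRS) over a signature $\mathcal{F}$ and an infinite set $\mathcal{V}$ of variables: a (possibly infinite) set of rules $l \to r$ such that $l$ is not a variable, every variable of $r$ occurs in $l$, and every variable occurs at most once in $l$ and at most once in $r$. For $\gamma \in \mathcal{R}$ write $s \to_\gamma t$ if $t$ arises from $s$ by one application of the rule $\gamma$, and let ${\to_{\mathcal{R}}} = \bigcup_{\gamma \in \mathcal{R}} {\to_\gamma}$. An \emph{overlap} $(l_1 \to r_1, p, l_2 \to r_2)_\mu$ of $\mathcal{R}$ consists of variants $l_1 \to r_1$ and $l_2 \to r_2$, without common variables, of rules $\alpha$ and $\beta$ of $\mathcal{R}$, a position $p$ of $l_2$ at which $l_2$ has a function symbol, and a most general unifier $\mu$ of $l_1$ and $l_2|_p$, where for $p = \epsilon$ it is required that $l_1 \to r_1$ and $l_2 \to r_2$ are not variants of each other. It induces the critical pair $(l_2[r_1]_p\mu,\; r_2\mu)$. For terms $s, t$ and $k \geqslant 0$, a \emph{$k$-join instance} of $(s,t)$ is a pair $((\gamma_1,\dots,\gamma_m),(\delta_1,\dots,\delta_n))$ of sequences of rules of $\mathcal{R}$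 with $m, n \leqslant k$ for which there is a term $w$ with $s \to_{\gamma_1} \cdots \to_{\gamma_m} w$ and $t \to_{\delta_1} \cdots \to_{\delta_n} w$. Let $J_k(s,t)$ be the set of those $k$-join instances of $(s,t)$ that are minimal with respect to the componentwise subsequence order. \emph{Precedence constraints} are built by conjunction and disjunction from $\top$, $\bot$ and the atoms $\alpha > \beta$ and $\alpha \geqslant \beta$, where $\alpha, \beta$ are variables corresponding to the rules of $\mathcal{R}$. A precedence constraint is \emph{satisfiable} if it is true for some well-founded order $>$ on $\mathcal{R}$ and some quasi-order $\geqslant$ on $\mathcal{R}$ with ${\geqslant} \cdot {>} \cdot {\geqslant} \subseteq {>}$ (for instance, for a well-founded order $>$ and its reflexive closure $\geqslant$). For $\alpha, \beta \in \mathcal{R}$ and a sequence $(\gamma_1, \dots, \gamma_n)$ of rules let \[ \Phi^\alpha_\beta((\gamma_1,\dots,\gamma_n)) \;=\; \bigvee_{1 \leqslant i \leqslant n+1} \Bigl( \bigwedge_{1 \leqslant j < i} \alpha > \gamma_j \;\land\; \Psi_{i,n} \Bigr), \] where $\Psi_{n+1,n} = \top$ and $\Psi_{i,n} = \bigl(\beta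 \geqslant \gamma_i \land \bigwedge_{i < j \leqslant n} (\alpha > \gamma_j \lor \beta > \gamma_j)\bigr)$ for $1 \leqslant i \leqslant n$. Let $\mathsf{RL}_k(\mathcal{R})$ be the conjunction, over all overlaps $(l_1 \to r_1, p, l_2 \to r_2)_\mu$ of $\mathcal{R}$, where $l_1 \to r_1$ and $l_2 \to r_2$ are variants of the rules $\alpha$ and $\beta$, of the constraints \[ \bigvee \bigl\{ \Phi^{\alpha}_{\beta}(\vec\gamma) \land \Phi^{\beta}_{\alpha}(\vec\delta) \bigm| (\vec\gamma,\vec\delta) \in J_k(l_2[r_1]_p\mu,\, r_2\mu) \bigr\}. \] \textbf{Theorem.} If $\mathsf{RL}_k(\mathcal{R})$ is satisfiable for some $k \geqslant 0$, then $\mathcal{R}$ is confluent, i.e., whenever $u \leftarrow_{\mathcal{R}}^* s \to_{\mathcal{R}}^* v$ there is a term $w$ with $u \to_{\mathcal{R}}^* w \leftarrow_{\mathcal{R}}^* v$. -/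

import Mathlib

namespace Rewriting



/-! ### Terms, positions, substitutions

Terms `𝒯(ℱ, 𝒱)` are the first-order terms `L.Term V` over the function symbols of `L` with
variables from `V` (the relation symbols of `L` play no role). A substitution is a map
`V → L.Term V`; its application to `t` is `t.subst σ`. Renaming variables is `t.relabel`. -/

universe u v w

variable {L : FirstOrder.Language.{u, v}} {V : Type w}

/-- The subterm `t|_p`; it is `none` if `p` is not a position of `t`. A position is a list of
argument indices, the root position being `[]`. -/
def subtermAt : L.Term V → List ℕ → Option (L.Term V)
  | t, [] => some t
  | .var _, _ :: _ => none
  | .func (l := n) _ ts, i :: p => if h : i < n then subtermAt (ts ⟨i, h⟩) p else none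

/-- The term `t[s]_p`: the subterm of `t` at position `p` is replaced by `s`
(only used for positions `p` of `t`; otherwise the result is `t`). -/
def replaceAt : L.Term V → List ℕ → L.Term V → L.Term V
  | _, [], s => s
  | .var x, _ :: _, _ => .var x
  | .func (l := n) f ts, i :: p, s =>
      .func f fun j : Fin n => if (j : ℕ) = i then replaceAt (ts j) p s else ts j

/-- `Var(t)`, the set of variables occurring in `t`. -/
def varsOf (t : L.Term V) : Set V := {x | ∃ p, subtermAt t p = some (.var x)}

/-- `t` is a variable. -/
def IsVar (t : L.Term V) : Prop := ∃ x, t = .var x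

/-- `t` is linear: every variable occurs at most once in `t`. -/
def LinearTerm (t : L.Term V) : Prop :=
  ∀ (x : V) (p q : List ℕ),
    subtermAt t p = some (.var x) → subtermAt t q = some (.var x) → p = q

/-- `μ` is a unifier of `s` and `t`. -/
def IsUnifier (μ : V → L.Term V) (s t : L.Term V) : Prop := s.subst μ = t.subst μ

/-- `μ` is a most general unifier of `s` and `t`: every unifier factors through `μ`. -/
def IsMGU (μ : V → L.Term V) (s t : L.Term V) : Prop :=
  IsUnifier μ s t ∧
    ∀ τ : V → L.Term V, IsUnifier τ s t → ∃ δ : V → L.Term V, ∀ x, τ x = (μ x).subst δ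

/-! ### Rewrite rules and term rewrite systems -/

/-- A pair of terms `lhs → rhs`. -/
structure Rule (L : FirstOrder.Language.{u, v}) (V : Type w) where
  lhs : L.Term V
  rhs : L.Term V

/-- Two rules are variants if they are equal up to a (bijective) renaming of variables. -/
def IsVariant (ρ ρ' : Rule L V) : Prop :=
  ∃ π : Equiv.Perm V, ρ'.lhs = ρ.lhs.relabel π ∧ ρ'.rhs = ρ.rhs.relabel π

/-- The variables occurring in a rule. -/
def Rule.vars (ρ : Rule L V) : Set V := varsOf ρ.lhs ∪ varsOf ρ.rhs

/-- A term rewrite system: a (possibly infinite) set of rules `l → r` such that `l` is not a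
variable and every variable of `r` occurs in `l`. -/
structure TRS (L : FirstOrder.Language.{u, v}) (V : Type w) where
  rules : Set (Rule L V)
  lhs_not_var : ∀ ρ ∈ rules, ¬ IsVar ρ.lhs
  vars_subset : ∀ ρ ∈ rules, varsOf ρ.rhs ⊆ varsOf ρ.lhs

/-- A TRS is linear if both sides of all its rules are linear terms. -/
def TRS.Linear (R : TRS L V) : Prop :=
  ∀ ρ ∈ R.rules, LinearTerm ρ.lhs ∧ LinearTerm ρ.rhs

/-- The rewrite step `s →_ρ t` using the rule `ρ`. -/
def Rule.Step (ρ : Rule L V) (s t : L.Term V) : Prop :=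
  ∃ (p : List ℕ) (σ : V → L.Term V),
    subtermAt s p = some (ρ.lhs.subst σ) ∧ t = replaceAt s p (ρ.rhs.subst σ)

/-- The rewrite relation `→_R`. -/
def TRS.Rewrites (R : TRS L V) (s t : L.Term V) : Prop := ∃ ρ ∈ R.rules, ρ.Step s t

/-- Confluence of a relation: `←* · →* ⊆ →* · ←*`. -/
def Confluent {A : Type*} (r : A → A → Prop) : Prop :=
  ∀ a b c, Relation.ReflTransGen r a b → Relation.ReflTransGen r a c →
    Relation.Join (Relation.ReflTransGen r) b c

/-- A TRS is confluent if its rewrite relation on the set of all terms is confluent. -/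
def TRS.IsConfluent (R : TRS L V) : Prop := Confluent R.Rewrites

/-- An overlap `(l₁ → r₁, p, l₂ → r₂)_μ` of `R`. Here `inner = l₁ → r₁` and `outer = l₂ → r₂`
are variants, without common variables, of the rules `α` and `β` of `R`. -/
structure Overlap (R : TRS L V) where
  α : R.rules
  β : R.rules
  inner : Rule L V
  outer : Rule L V
  inner_variant : IsVariant α.1 inner
  outer_variant : IsVariant β.1 outer
  disjoint_vars : Disjoint inner.vars outer.vars
  pos : List ℕ
  sub : L.Term V
  sub_eq : subtermAt outer.lhs pos = some sub
  /-- `pos` is a function position of the left-hand side of `outer`. -/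
  sub_not_var : ¬ IsVar sub
  mgu : V → L.Term V
  isMGU : IsMGU mgu inner.lhs sub
  not_variants_of_root : pos = [] → ¬ IsVariant inner outer

/-- The left component `l₂[r₁]_p μ` of the critical pair induced by an overlap. -/
def Overlap.left {R : TRS L V} (o : Overlap R) : L.Term V :=
  (replaceAt o.outer.lhs o.pos o.inner.rhs).subst o.mgu

/-- The right component `r₂ μ` of the critical pair induced by an overlap. -/
def Overlap.right {R : TRS L V} (o : Overlap R) : L.Term V :=
  o.outer.rhs.subst o.mgu

/-! ### Join instances -/

/-- `StepsAlong [γ₁, …, γₘ] s t` means `s →_{γ₁} · ⋯ · →_{γₘ} t`. -/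
def StepsAlong {R : TRS L V} : List R.rules → L.Term V → L.Term V → Prop
  | [], s, t => s = t
  | γ :: γs, s, t => ∃ s', γ.1.Step s s' ∧ StepsAlong γs s' t

/-- `(γs, δs)` is a `k`-join instance of `(s, t)`. -/
def IsJoinInstance (R : TRS L V) (k : ℕ) (s t : L.Term V)
    (J : List R.rules × List R.rules) : Prop :=
  J.1.length ≤ k ∧ J.2.length ≤ k ∧ ∃ w, StepsAlong J.1 s w ∧ StepsAlong J.2 t w

/-- `J_k(s, t)`: the `k`-join instances of `(s, t)` that are minimal with respect to the
componentwise embedding order on pairs of sequences. -/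
def minimalJoinInstances (R : TRS L V) (k : ℕ) (s t : L.Term V) :
    Set (List R.rules × List R.rules) :=
  {J | IsJoinInstance R k s t J ∧
    ∀ J', IsJoinInstance R k s t J' → J'.1.Sublist J.1 → J'.2.Sublist J.2 → J' = J}

/-! ### Precedence constraints -/

/-- Precedence constraints over a set `I` of variables. The connectives `bigOr` and `bigAnd` over
arbitrary families are needed because a TRS may be infinite, and because overlaps range over all
variants of rules and all most general unifiers. (For a finite TRS only finitely many different
members occur up to renaming of variables.) -/
inductive PrecConstraint (I : Type u) : Type (u + 1)
  | top : PrecConstraint I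
  | bot : PrecConstraint I
  | or : PrecConstraint I → PrecConstraint I → PrecConstraint I
  | and : PrecConstraint I → PrecConstraint I → PrecConstraint I
  | gt : I → I → PrecConstraint I
  | ge : I → I → PrecConstraint I
  | bigOr {ι : Type u} : (ι → PrecConstraint I) → PrecConstraint I
  | bigAnd {ι : Type u} : (ι → PrecConstraint I) → PrecConstraint I

namespace PrecConstraint

variable {I : Type u}

/-- Finite disjunction. -/
def disj (φs : List (PrecConstraint I)) : PrecConstraint I := φs.foldr or bot

/-- Finite conjunction. -/
def conj (φs : List (PrecConstraint I)) : PrecConstraint I := φs.foldr and top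

/-- Truth of a precedence constraint when `>` and `⩾` are interpreted by the given relations. -/
def Holds (gtR geR : I → I → Prop) : PrecConstraint I → Prop
  | top => True
  | bot => False
  | or φ ψ => Holds gtR geR φ ∨ Holds gtR geR ψ
  | and φ ψ => Holds gtR geR φ ∧ Holds gtR geR ψ
  | gt a b => gtR a b
  | ge a b => geR a b
  | bigOr φ => ∃ i, Holds gtR geR (φ i)
  | bigAnd φ => ∀ i, Holds gtR geR (φ i)

/-- A precedence `(>, ⩾)` on `I`: a well-founded (strict) order `>` together with a quasi-order `⩾`
such that `⩾ · > · ⩾ ⊆ >`. -/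
structure IsPrecedence (gtR geR : I → I → Prop) : Prop where
  gt_trans : ∀ a b c, gtR a b → gtR b c → gtR a c
  /-- There is no infinite descending sequence `a₀ > a₁ > ⋯`. -/
  gt_wf : WellFounded fun a b => gtR b a
  ge_refl : ∀ a, geR a a
  ge_trans : ∀ a b c, geR a b → geR b c → geR a c
  compat : ∀ a b c d, geR a b → gtR b c → geR c d → gtR a d

/-- A precedence constraint is satisfiable if some precedence makes it true. -/
def Satisfiable (φ : PrecConstraint I) : Prop :=
  ∃ gtR geR : I → I → Prop, IsPrecedence gtR geR ∧ Holds gtR geR φ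

end PrecConstraint

/-! ### The encoding of the rule-labeling heuristic -/

section Encoding

open PrecConstraint

/-- For the sequence `γs = (γ₁, …, γₙ)` and `1 ≤ i ≤ n + 1` (the argument here is `i - 1`):
`⊤` if `i = n + 1`, and `β ⩾ γᵢ ∧ ⋀_{i < j ≤ n} (α > γⱼ ∨ β > γⱼ)` if `i ≤ n`. -/
def Psi {I : Type u} (α β : I) (γs : List I) (i : ℕ) : PrecConstraint I :=
  match γs.drop i with
  | [] => top
  | γ :: rest => and (ge β γ) (conj (rest.map fun δ => or (gt α δ) (gt β δ)))

/-- `Φ^α_β(γ₁, …, γₙ) = ⋁_{1 ≤ i ≤ n + 1} (⋀_{j < i} α > γⱼ ∧ Ψᵢ)`. -/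
def Phi {I : Type u} (α β : I) (γs : List I) : PrecConstraint I :=
  disj ((List.range (γs.length + 1)).map fun i =>
    and (conj ((γs.take i).map fun γ => gt α γ)) (Psi α β γs i))

/-- The formula `RL_k(R)`: the conjunction over all overlaps of `R` of the disjunctions over all
minimal `k`-join instances `(γs, δs)` of the induced critical pair of `Φ^α_β(γs) ∧ Φ^β_α(δs)`. -/
def RL (k : ℕ) (R : TRS L V) : PrecConstraint R.rules :=
  bigAnd fun o : Overlap R =>
    bigOr fun J : minimalJoinInstances R k o.left o.right =>
      and (Phi o.α o.β J.1.1) (Phi o.β o.α J.1.2)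

end Encoding

end Rewriting

/-!
The proof labels every rewrite step by the rule used and applies van Oostrom's decreasing diagrams
technique.

*Labels.* A precedence `(>, ⩾)` is replaced by the ordinal rank of rules with respect to `>`: by
`⩾ · > · ⩾ ⊆ >`, the rank also respects `⩾` (`PrecConstraint.IsPrecedence.exists_rank`). With
`rankedStep rk κ`, the steps by rules of rank at most `κ`, the problem concerns an increasing
family of relations indexed by a well-order.

*Local peaks.* Every local peak between steps with rules `α` and `β` is closed by sequences that
satisfy `Φ^α_β` and `Φ^β_α` (`decreasinglyJoinable_of_peak`). For parallel redexes, and for a redex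
inside the substitution part of another one, linearity of the rules closes the peak by at most one
step on each side, using the same two rules. Otherwise one redex overlaps with a function position
of the other left-hand side; since the rules are linear, a most general unifier of the renamed apart
left-hand sides is obtained by structural recursion (`exists_idempotent_mgu`), and the peak is an
instance of a critical peak, for which the hypothesis supplies a join instance, unless it is
trivial, being a peak of variants of one rule at the root.

*Confluence.* For the decreasing diagrams theorem (`IsLocallyDecreasing.confluent`), two facts
about a label `κ` are proved together by well-founded induction. First (`PushesThrough`), if
`b ←_κ a →*_l e` with `l < κ`, then, up to conversions with labels below `κ`, the `κ`-step can be
performed from `e` after further steps with labels *below* `l`, unless it vanishes. Second, `→_κ`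
is confluent: moving one of two `κ`-steps with sources `a →*_l a'` along this reduction leaves two
`κ`-steps whose sources are separated by smaller labels, so that iterating it leads to two
`κ`-steps from the same term, where the local diagram applies.
-/

namespace Rewriting

universe u v w

/-! ### Decreasing diagrams for labels in a well-order -/

section DecreasingDiagrams

open Relation

variable {ι : Type*} [LinearOrder ι] {A : Type*}

/-- The steps whose label is strictly below `κ`. -/
def below (S : ι → A → A → Prop) (κ : ι) (a b : A) : Prop := ∃ μ < κ, S μ a b

/-- The right-hand end of a diagram in which a `κ`-step into `b` has been moved along a reduction
ending in `e`: either the `κ`-step has vanished, or it is performed after further steps from `e`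
with labels below `l`, and in both cases its target is convertible to `b` below `κ`. -/
def Pushed (S : ι → A → A → Prop) (κ l : ι) (b e : A) : Prop :=
  EqvGen (below S κ) e b ∨
    ∃ f' f, ReflTransGen (below S l) e f' ∧ S κ f' f ∧ EqvGen (below S κ) f b

/-- Local decreasingness of a family of relations indexed by linearly ordered labels, where `S κ`
comprises the steps with label *at most* `κ`. The lower sides of the local diagrams may be closed
by conversions below the larger of the two labels. -/
structure IsLocallyDecreasing (S : ι → A → A → Prop) : Prop where
  mono : ∀ {l κ}, l ≤ κ → ∀ {a b}, S l a b → S κ a b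
  peak_lt : ∀ {l κ}, l < κ → ∀ {a b c}, S κ a b → S l a c → Pushed S κ l b c
  peak_eq : ∀ {κ a b c}, S κ a b → S κ a c → ∃ x y x' y',
    ReflTransGen (below S κ) b x ∧ ReflGen (S κ) x y ∧ EqvGen (below S κ) y y' ∧
      ReflGen (S κ) x' y' ∧ ReflTransGen (below S κ) c x'

/-- A `κ`-step can be moved along any reduction whose labels are at most some `l < κ`. -/
def PushesThrough (S : ι → A → A → Prop) (κ : ι) : Prop :=
  ∀ l < κ, ∀ a b e, S κ a b → ReflTransGen (S l) a e → Pushed S κ l b e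

/-- Reductions with at most `n` steps of label `l`, all other steps having labels below `l`. -/
def Chain (S : ι → A → A → Prop) (l : ι) : ℕ → A → A → Prop
  | 0, a, e => ReflTransGen (below S l) a e
  | n + 1, a, e => ∃ a₀ a₁, ReflTransGen (below S l) a a₀ ∧ ReflGen (S l) a₀ a₁ ∧ Chain S l n a₁ e

theorem eqvGen_of_reflTransGen {r : A → A → Prop} {a b : A} (h : ReflTransGen r a b) :
    EqvGen r a b := by
  induction h with
  | refl => exact .refl _
  | tail _ h ih => exact .trans _ _ _ ih (.rel _ _ h)

theorem Confluent.join_of_eqvGen {r : A → A → Prop} (hr : Confluent r) {a b : A}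
    (h : EqvGen r a b) : ∃ c, ReflTransGen r a c ∧ ReflTransGen r b c := by
  induction h with
  | rel _ y h => exact ⟨y, .single h, .refl⟩
  | refl x => exact ⟨x, .refl, .refl⟩
  | symm _ _ _ ih => obtain ⟨c, h₁, h₂⟩ := ih; exact ⟨c, h₂, h₁⟩
  | trans _ _ _ _ _ ih₁ ih₂ =>
    obtain ⟨c, h₁, h₂⟩ := ih₁
    obtain ⟨d, h₃, h₄⟩ := ih₂
    obtain ⟨e, h₅, h₆⟩ := hr _ _ _ h₂ h₃
    exact ⟨e, h₁.trans h₅, h₄.trans h₆⟩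

variable {S : ι → A → A → Prop}

theorem below_mono {l κ : ι} (h : l ≤ κ) {a b : A} : below S l a b → below S κ a b :=
  fun ⟨μ, hμ, hs⟩ => ⟨μ, hμ.trans_le h, hs⟩

theorem reflTransGen_below_mono {l κ : ι} (h : l ≤ κ) {a b : A}
    (hab : ReflTransGen (below S l) a b) : ReflTransGen (below S κ) a b :=
  ReflTransGen.mono (fun _ _ => below_mono h) _ _ hab

theorem reflTransGen_below_of_lt {l κ : ι} (h : l < κ) {a b : A}
    (hab : ReflTransGen (S l) a b) : ReflTransGen (below S κ) a b :=
  ReflTransGen.mono (fun _ _ hs => ⟨l, h, hs⟩) _ _ hab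

theorem IsLocallyDecreasing.reflTransGen_of_below (h : IsLocallyDecreasing S) {κ : ι} {a b : A}
    (hab : ReflTransGen (below S κ) a b) : ReflTransGen (S κ) a b :=
  ReflTransGen.mono (fun _ _ ⟨_, hμ, hs⟩ => h.mono hμ.le hs) _ _ hab

theorem IsLocallyDecreasing.reflTransGen_mono (h : IsLocallyDecreasing S) {l κ : ι} (hl : l ≤ κ)
    {a b : A} (hab : ReflTransGen (S l) a b) : ReflTransGen (S κ) a b :=
  ReflTransGen.mono (fun _ _ hs => h.mono hl hs) _ _ hab

/-- A nonempty reduction below `κ` has a largest label. -/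
theorem IsLocallyDecreasing.eq_or_exists_of_below (h : IsLocallyDecreasing S) {κ : ι} {a b : A}
    (hab : ReflTransGen (below S κ) a b) : a = b ∨ ∃ μ < κ, ReflTransGen (S μ) a b := by
  induction hab with
  | refl => exact .inl rfl
  | tail _ hs ih =>
    obtain ⟨ν, hν, hs⟩ := hs
    right
    rcases ih with rfl | ⟨μ, hμ, hab⟩
    · exact ⟨ν, hν, .single hs⟩
    · exact ⟨max μ ν, max_lt hμ hν, (h.reflTransGen_mono (le_max_left _ _) hab).tail
        (h.mono (le_max_right _ _) hs)⟩

theorem IsLocallyDecreasing.confluent_below (h : IsLocallyDecreasing S) {κ : ι}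
    (hκ : ∀ l < κ, Confluent (S l)) : Confluent (below S κ) := by
  intro a b c hab hac
  rcases h.eq_or_exists_of_below hab with rfl | ⟨μ, hμ, hab'⟩
  · exact ⟨c, hac, .refl⟩
  rcases h.eq_or_exists_of_below hac with rfl | ⟨ν, hν, hac'⟩
  · exact ⟨b, .refl, hab⟩
  obtain ⟨d, hb, hc⟩ := hκ _ (max_lt hμ hν) a b c
    (h.reflTransGen_mono (le_max_left _ _) hab') (h.reflTransGen_mono (le_max_right _ _) hac')
  exact ⟨d, reflTransGen_below_of_lt (max_lt hμ hν) hb,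
    reflTransGen_below_of_lt (max_lt hμ hν) hc⟩

theorem Chain.head {l : ι} {n : ℕ} {a b e : A} (hab : ReflTransGen (below S l) a b)
    (h : Chain S l n b e) : Chain S l n a e := by
  cases n with
  | zero => exact ReflTransGen.trans hab h
  | succ n => obtain ⟨a₀, a₁, h₀, h₁, h₂⟩ := h; exact ⟨a₀, a₁, hab.trans h₀, h₁, h₂⟩

theorem Chain.tail {l : ι} {n : ℕ} {a b e : A} (h : Chain S l n a b)
    (hbe : ReflTransGen (below S l) b e) : Chain S l n a e := by
  induction n generalizing a with
  | zero => exact ReflTransGen.trans h hbe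
  | succ n ih => obtain ⟨a₀, a₁, h₀, h₁, h₂⟩ := h; exact ⟨a₀, a₁, h₀, h₁, ih h₂⟩

theorem IsLocallyDecreasing.reflTransGen_of_chain (h : IsLocallyDecreasing S) {l : ι} {n : ℕ}
    {a e : A} (hc : Chain S l n a e) : ReflTransGen (S l) a e := by
  induction n generalizing a with
  | zero => exact h.reflTransGen_of_below hc
  | succ n ih =>
    obtain ⟨a₀, a₁, h₀, h₁, h₂⟩ := hc
    exact ((h.reflTransGen_of_below h₀).trans h₁.to_reflTransGen).trans (ih h₂)

theorem exists_chain_of_reflTransGen {l : ι} {a e : A} (h : ReflTransGen (S l) a e) :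
    ∃ n, Chain S l n a e := by
  induction h using ReflTransGen.head_induction_on with
  | refl => exact ⟨0, .refl⟩
  | head hs _ ih => obtain ⟨n, hn⟩ := ih; exact ⟨n + 1, _, _, .refl, .single hs, hn⟩

theorem Pushed.mono {κ l l' : ι} (hl : l ≤ l') {b e : A} (h : Pushed S κ l b e) :
    Pushed S κ l' b e := by
  rcases h with h | ⟨f', f, h₁, h₂, h₃⟩
  · exact .inl h
  · exact .inr ⟨f', f, reflTransGen_below_mono hl h₁, h₂, h₃⟩

theorem Pushed.head {κ l : ι} (hl : l ≤ κ) {b e e' : A} (he : ReflTransGen (below S l) e e')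
    (h : Pushed S κ l b e') : Pushed S κ l b e := by
  rcases h with h | ⟨f', f, h₁, h₂, h₃⟩
  · exact .inl (.trans _ _ _ (eqvGen_of_reflTransGen (reflTransGen_below_mono hl he)) h)
  · exact .inr ⟨f', f, he.trans h₁, h₂, h₃⟩

theorem Pushed.trans {κ l : ι} {b b' e : A} (h : Pushed S κ l b e)
    (hb : EqvGen (below S κ) b b') : Pushed S κ l b' e := by
  rcases h with h | ⟨f', f, h₁, h₂, h₃⟩
  · exact .inl (.trans _ _ _ h hb)
  · exact .inr ⟨f', f, h₁, h₂, .trans _ _ _ h₃ hb⟩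

/-- Moving a `κ`-step along a reduction below `κ`, without control over the labels of the steps
preceding the moved step. -/
theorem PushesThrough.pushed_below (h : IsLocallyDecreasing S) {κ : ι}
    (hX : PushesThrough S κ) {a b e : A} (hab : S κ a b) (hae : ReflTransGen (below S κ) a e) :
    Pushed S κ κ b e := by
  rcases h.eq_or_exists_of_below hae with rfl | ⟨μ, hμ, hae⟩
  · exact .inr ⟨a, b, .refl, hab, .refl _⟩
  · exact (hX μ hμ a b e hab hae).mono hμ.le

/-- A reduction below `l` and a reduction with at most `n` steps of label `l` can be closed so that
the number of steps of label `l` does not increase. -/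
theorem Chain.strip (h : IsLocallyDecreasing S) {l : ι} (hC : Confluent (below S l))
    (hX : PushesThrough S l) {n : ℕ} {a e a' : A} (hc : Chain S l n a e)
    (ha : ReflTransGen (below S l) a a') :
    ∃ e', Chain S l n a' e' ∧ ReflTransGen (below S l) e e' := by
  induction n generalizing a a' with
  | zero =>
    obtain ⟨e', h₁, h₂⟩ := hC _ _ _ ha hc
    exact ⟨e', h₁, h₂⟩
  | succ n ih =>
    obtain ⟨a₀, a₁, h₀, h₁, h₂⟩ := hc
    obtain ⟨a₀', h₃, h₄⟩ := hC _ _ _ ha h₀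
    cases h₁ with
    | refl =>
      obtain ⟨e', h₅, h₆⟩ := ih h₂ h₄
      exact ⟨e', ⟨a₀', a₀', h₃, .refl, h₅⟩, h₆⟩
    | single h₁ =>
      rcases PushesThrough.pushed_below h hX h₁ h₄ with h₅ | ⟨f', f, h₅, h₆, h₇⟩
      · obtain ⟨g, hg, hg'⟩ := hC.join_of_eqvGen h₅
        obtain ⟨e', he, he'⟩ := ih h₂ hg'
        exact ⟨e', ⟨a₀', a₀', h₃, .refl, he.head hg⟩, he'⟩
      · obtain ⟨g, hg, hg'⟩ := hC.join_of_eqvGen h₇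
        obtain ⟨e', he, he'⟩ := ih h₂ hg'
        exact ⟨e', ⟨f', f, h₃.trans h₅, .single h₆, he.head hg⟩, he'⟩

/-- The case of `IsLocallyDecreasing.pushed_of_chain` in which the local diagram applies: the
reduction along which the `κ`-step is moved starts with a step of label `l`. -/
theorem IsLocallyDecreasing.pushed_of_step (h : IsLocallyDecreasing S) {l κ : ι} (hl : l < κ)
    (hC : Confluent (below S l)) (hX : PushesThrough S l) {n : ℕ}
    (ih : ∀ a b e, Chain S l n a e → S κ a b → Pushed S κ l b e) {a b a₁ e : A}
    (hab : S κ a b) (ha : S l a a₁) (hc : Chain S l n a₁ e) : Pushed S κ l b e := by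
  have he : EqvGen (below S κ) e a₁ :=
    (eqvGen_of_reflTransGen (reflTransGen_below_of_lt hl (h.reflTransGen_of_chain hc))).symm
  rcases h.peak_lt hl hab ha with h₁ | ⟨f', f, h₁, h₂, h₃⟩
  · exact .inl (.trans _ _ _ he h₁)
  · obtain ⟨e', h₄, h₅⟩ := hc.strip h hC hX h₁
    exact ((ih _ _ _ h₄ h₂).head hl.le h₅).trans h₃

variable [WellFoundedLT ι]

theorem IsLocallyDecreasing.pushed_of_chain (h : IsLocallyDecreasing S) {l κ : ι} (hl : l < κ)
    (hC : Confluent (below S l)) (hX : PushesThrough S l)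
    (hlow : ∀ μ < l, ∀ a b e, S κ a b → ReflTransGen (S μ) a e → Pushed S κ μ b e) (n : ℕ) :
    ∀ a b e, Chain S l n a e → S κ a b → Pushed S κ l b e := by
  have hT : ∀ {x y}, ReflTransGen (below S l) x y → EqvGen (below S κ) x y := fun hxy =>
    eqvGen_of_reflTransGen (reflTransGen_below_mono hl.le hxy)
  have hzero : ∀ a b e, ReflTransGen (below S l) a e → S κ a b → Pushed S κ l b e := by
    intro a b e hae hab
    rcases h.eq_or_exists_of_below hae with rfl | ⟨μ, hμ, hae⟩
    · exact .inr ⟨a, b, .refl, hab, .refl _⟩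
    · exact (hlow μ hμ a b e hab hae).mono hμ.le
  induction n with
  | zero => exact fun a b e hae hab => hzero a b e hae hab
  | succ n ih =>
    -- The step of label `l` nearest to the `κ`-step is reached after a prefix with labels at most
    -- `μ < l`; moving the `κ`-step along this prefix makes `μ` smaller.
    have key : ∀ μ < l, ∀ a b a₀ a₁ e, S κ a b → ReflTransGen (S μ) a a₀ → S l a₀ a₁ →
        Chain S l n a₁ e → Pushed S κ l b e := by
      intro μ
      induction μ using WellFoundedLT.induction with
      | ind μ ihμ =>
        intro hμ a b a₀ a₁ e hab ha₀ ha₁ hc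
        have he : EqvGen (below S κ) e a₀ := .symm _ _ <|
          .trans _ _ _ (.rel _ _ ⟨l, hl, ha₁⟩)
            (eqvGen_of_reflTransGen (reflTransGen_below_of_lt hl (h.reflTransGen_of_chain hc)))
        rcases hlow μ hμ a b a₀ hab ha₀ with h₁ | ⟨f', f, h₁, h₂, h₃⟩
        · exact .inl (.trans _ _ _ he h₁)
        refine Pushed.trans ?_ h₃
        rcases h.eq_or_exists_of_below h₁ with rfl | ⟨ν, hν, h₄⟩
        · exact h.pushed_of_step hl hC hX ih h₂ ha₁ hc
        rcases hX ν (hν.trans hμ) _ _ _ ha₁ h₄ with h₅ | ⟨g', g, h₅, h₆, h₇⟩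
        · obtain ⟨j, hj, hj'⟩ := hC.join_of_eqvGen h₅
          obtain ⟨e', h₈, h₉⟩ := hc.strip h hC hX hj'
          exact (ih _ _ _ (h₈.head hj) h₂).head hl.le h₉
        · obtain ⟨j, hj, hj'⟩ := hC.join_of_eqvGen h₇
          obtain ⟨e', h₈, h₉⟩ := hc.strip h hC hX hj'
          exact (ihμ ν hν (hν.trans hμ) f' f g' g e' h₂ (h.reflTransGen_of_below h₅) h₆
            (h₈.head hj)).head hl.le h₉
    rintro a b e ⟨a₀, a₁, h₀, h₁, h₂⟩ hab
    cases h₁ with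
    | refl => exact ih _ _ _ (h₂.head h₀) hab
    | single h₁ =>
      rcases h.eq_or_exists_of_below h₀ with rfl | ⟨μ, hμ, h₀⟩
      · exact h.pushed_of_step hl hC hX ih hab h₁ h₂
      · exact key μ hμ a b a₀ a₁ e hab h₀ h₁ h₂

theorem IsLocallyDecreasing.pushesThrough (h : IsLocallyDecreasing S) {κ : ι}
    (ih : ∀ l < κ, PushesThrough S l ∧ Confluent (S l)) : PushesThrough S κ := by
  intro l
  induction l using WellFoundedLT.induction with
  | ind l ihl =>
    intro hl a b e hab hae
    obtain ⟨n, hn⟩ := exists_chain_of_reflTransGen hae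
    exact h.pushed_of_chain hl (h.confluent_below fun μ hμ => (ih μ (hμ.trans hl)).2) (ih l hl).1
      (fun μ hμ => ihl μ hμ (hμ.trans hl)) n a b e hn hab

/-- The reductions with at most one step of label `κ` and otherwise labels below `κ` have the
diamond property. -/
theorem IsLocallyDecreasing.diamond (h : IsLocallyDecreasing S) {κ : ι}
    (hC : Confluent (below S κ)) (hX : PushesThrough S κ) {a b c : A}
    (hab : Chain S κ 1 a b) (hac : Chain S κ 1 a c) :
    ∃ d, Chain S κ 1 b d ∧ Chain S κ 1 c d := by
  let J : A → A → Prop := fun b c => ∃ d, Chain S κ 1 b d ∧ Chain S κ 1 c d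
  have hsymm : ∀ {b c}, J b c → J c b := fun ⟨d, h₁, h₂⟩ => ⟨d, h₂, h₁⟩
  have hleft : ∀ {b b' c}, EqvGen (below S κ) b b' → J b' c → J b c := by
    rintro b b' c hb ⟨d, h₁, h₂⟩
    obtain ⟨j, hj, hj'⟩ := hC.join_of_eqvGen hb
    obtain ⟨d', h₃, h₄⟩ := h₁.strip h hC hX hj'
    exact ⟨d', h₃.head hj, h₂.tail h₄⟩
  have hchain : ∀ {b c}, Chain S κ 1 b c → J b c := fun hbc =>
    ⟨_, hbc, _, _, .refl, .refl, .refl⟩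
  have hsingle : ∀ {b c}, ReflGen (S κ) b c → Chain S κ 1 b c := fun hbc =>
    ⟨_, _, .refl, hbc, .refl⟩
  have hpeak : ∀ {a b c}, S κ a b → S κ a c → J b c := by
    intro a b c hab hac
    obtain ⟨x, y, x', y', h₁, h₂, h₃, h₄, h₅⟩ := h.peak_eq hab hac
    obtain ⟨d, h₆, h₇⟩ := hC.join_of_eqvGen h₃
    exact ⟨d, ⟨x, y, h₁, h₂, h₆⟩, ⟨x', y', h₅, h₄, h₇⟩⟩
  -- Two `κ`-steps whose sources are separated by a reduction below `κ`: moving one of the steps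
  -- along this reduction exchanges the roles of the two steps and makes the largest label smaller.
  have hone : ∀ l < κ, ∀ a a' b c, S κ a b → ReflTransGen (S l) a a' → S κ a' c → J b c := by
    intro l
    induction l using WellFoundedLT.induction with
    | ind l ih =>
      intro hl a a' b c hab haa hac
      rcases hX l hl a b a' hab haa with h₁ | ⟨f', f, h₁, h₂, h₃⟩
      · exact hleft h₁.symm (hchain (hsingle (.single hac)))
      refine hleft h₃.symm ?_
      rcases h.eq_or_exists_of_below h₁ with rfl | ⟨ν, hν, h₄⟩
      · exact hpeak h₂ hac
      · exact hsymm (ih ν hν (hν.trans hl) a' f' c f hac h₄ h₂)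
  obtain ⟨a₁, b₁, hb₁, hb₂, hb₃⟩ := hab
  obtain ⟨a₂, c₁, hc₁, hc₂, hc₃⟩ := hac
  refine hleft (eqvGen_of_reflTransGen hb₃).symm (hsymm (hleft (eqvGen_of_reflTransGen hc₃).symm
    (hsymm ?_)))
  have ha : EqvGen (below S κ) a₁ a₂ :=
    .trans _ _ _ (eqvGen_of_reflTransGen hb₁).symm (eqvGen_of_reflTransGen hc₁)
  cases hb₂ with
  | refl => exact hleft ha (hchain (hsingle hc₂))
  | single hb₂ =>
    cases hc₂ with
    | refl => exact hsymm (hleft ha.symm (hchain (hsingle (.single hb₂))))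
    | single hc₂ =>
      obtain ⟨e, he₁, he₂⟩ := hC.join_of_eqvGen ha
      rcases PushesThrough.pushed_below h hX hb₂ he₁ with h₁ | ⟨f', f, h₁, h₂, h₃⟩
      · exact hleft (.trans _ _ _ h₁.symm (eqvGen_of_reflTransGen he₂).symm)
          (hchain (hsingle (.single hc₂)))
      · refine hleft h₃.symm ?_
        rcases h.eq_or_exists_of_below (he₂.trans h₁) with rfl | ⟨ν, hν, h₄⟩
        · exact hpeak h₂ hc₂
        · exact hsymm (hone ν hν _ _ _ _ hc₂ h₄ h₂)

theorem IsLocallyDecreasing.confluent_of_pushesThrough (h : IsLocallyDecreasing S) {κ : ι}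
    (hC : Confluent (below S κ)) (hX : PushesThrough S κ) : Confluent (S κ) := by
  have h₁ : ∀ {a b}, ReflTransGen (S κ) a b → ReflTransGen (Chain S κ 1) a b := fun hab =>
    ReflTransGen.mono (fun _ _ hs => ⟨_, _, .refl, .single hs, .refl⟩) _ _ hab
  have h₂ : ∀ {a b}, ReflTransGen (Chain S κ 1) a b → ReflTransGen (S κ) a b := fun hab => by
    induction hab with
    | refl => exact .refl
    | tail _ hs ih => exact ih.trans (h.reflTransGen_of_chain hs)
  intro a b c hab hac
  obtain ⟨d, hb, hc⟩ := church_rosser (r := Chain S κ 1)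
    (fun a b c hab hac => by
      obtain ⟨d, hb, hc⟩ := h.diamond hC hX hab hac
      exact ⟨d, .single hb, .single hc⟩) (h₁ hab) (h₁ hac)
  exact ⟨d, h₂ hb, h₂ hc⟩

theorem IsLocallyDecreasing.pushesThrough_and_confluent (h : IsLocallyDecreasing S) (κ : ι) :
    PushesThrough S κ ∧ Confluent (S κ) := by
  induction κ using WellFoundedLT.induction with
  | ind κ ih =>
    have hX := h.pushesThrough ih
    exact ⟨hX, h.confluent_of_pushesThrough (h.confluent_below fun l hl => (ih l hl).2) hX⟩

/-- The decreasing diagrams theorem, for labels in a well-order. -/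
theorem IsLocallyDecreasing.confluent (h : IsLocallyDecreasing S) :
    Confluent fun a b => ∃ κ, S κ a b := by
  have hlab : ∀ {a b}, ReflTransGen (fun a b => ∃ κ, S κ a b) a b →
      a = b ∨ ∃ κ, ReflTransGen (S κ) a b := by
    intro a b hab
    induction hab with
    | refl => exact .inl rfl
    | tail _ hs ih =>
      obtain ⟨ν, hs⟩ := hs
      right
      rcases ih with rfl | ⟨μ, hab⟩
      · exact ⟨ν, .single hs⟩
      · exact ⟨max μ ν, (h.reflTransGen_mono (le_max_left _ _) hab).tail
          (h.mono (le_max_right _ _) hs)⟩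
  intro a b c hab hac
  rcases hlab hab with rfl | ⟨μ, hab'⟩
  · exact ⟨c, hac, .refl⟩
  rcases hlab hac with rfl | ⟨ν, hac'⟩
  · exact ⟨b, .refl, hab⟩
  obtain ⟨d, hb, hc⟩ := (h.pushesThrough_and_confluent (max μ ν)).2 a b c
    (h.reflTransGen_mono (le_max_left _ _) hab') (h.reflTransGen_mono (le_max_right _ _) hac')
  exact ⟨d, ReflTransGen.mono (fun _ _ hs => ⟨_, hs⟩) _ _ hb,
    ReflTransGen.mono (fun _ _ hs => ⟨_, hs⟩) _ _ hc⟩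

end DecreasingDiagrams

/-! ### Positions, variables and linear terms -/

section Terms

open FirstOrder.Language

variable {L : FirstOrder.Language.{u, v}} {V : Type w}

@[simp]
theorem subtermAt_nil (t : L.Term V) : subtermAt t [] = some t := by
  cases t <;> rfl

@[simp]
theorem subtermAt_var_cons (x : V) (i : ℕ) (p : List ℕ) :
    subtermAt (.var x : L.Term V) (i :: p) = none := rfl

theorem subtermAt_func_cons {n : ℕ} (f : L.Functions n) (ts : Fin n → L.Term V) (i : ℕ)
    (p : List ℕ) : subtermAt (.func f ts) (i :: p) =
      if h : i < n then subtermAt (ts ⟨i, h⟩) p else none := rfl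

@[simp]
theorem subtermAt_func_fin {n : ℕ} (f : L.Functions n) (ts : Fin n → L.Term V) (i : Fin n)
    (p : List ℕ) : subtermAt (.func f ts) ((i : ℕ) :: p) = subtermAt (ts i) p := by
  simp [subtermAt_func_cons]

/-- A position below the root of a term leads into one of the arguments. -/
theorem exists_fin_of_subtermAt_cons {n : ℕ} {f : L.Functions n} {ts : Fin n → L.Term V} {i : ℕ}
    {p : List ℕ} {u : L.Term V} (h : subtermAt (.func f ts) (i :: p) = some u) :
    ∃ j : Fin n, i = j ∧ subtermAt (ts j) p = some u := by
  rw [subtermAt_func_cons] at h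
  split_ifs at h with hi
  exact ⟨⟨i, hi⟩, rfl, h⟩

@[simp]
theorem replaceAt_nil (t s : L.Term V) : replaceAt t [] s = s := by
  cases t <;> rfl

@[simp]
theorem replaceAt_func_fin {n : ℕ} (f : L.Functions n) (ts : Fin n → L.Term V) (i : Fin n)
    (p : List ℕ) (s : L.Term V) : replaceAt (.func f ts) ((i : ℕ) :: p) s =
      .func f (Function.update ts i (replaceAt (ts i) p s)) := by
  simp only [replaceAt, Term.func.injEq, heq_eq_eq, true_and]
  funext j
  by_cases hj : j = i
  · subst hj; simp
  · simp [hj, Fin.val_inj]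

theorem subtermAt_append {t u : L.Term V} {p : List ℕ} (q : List ℕ)
    (h : subtermAt t p = some u) : subtermAt t (p ++ q) = subtermAt u q := by
  induction p generalizing t with
  | nil => simp at h; simp [h]
  | cons i p ih =>
    cases t with
    | var x => simp at h
    | func f ts =>
      obtain ⟨j, rfl, hj⟩ := exists_fin_of_subtermAt_cons h
      simpa using ih hj

theorem replaceAt_append {t u : L.Term V} {p : List ℕ} (q : List ℕ) (s : L.Term V)
    (h : subtermAt t p = some u) : replaceAt t (p ++ q) s = replaceAt t p (replaceAt u q s) := by
  induction p generalizing t with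
  | nil => simp at h; simp [h]
  | cons i p ih =>
    cases t with
    | var x => simp at h
    | func f ts =>
      obtain ⟨j, rfl, hj⟩ := exists_fin_of_subtermAt_cons h
      simp [ih hj]

theorem subtermAt_subst {t u : L.Term V} {p : List ℕ} (σ : V → L.Term V)
    (h : subtermAt t p = some u) : subtermAt (t.subst σ) p = some (u.subst σ) := by
  induction p generalizing t with
  | nil => simp at h; simp [h]
  | cons i p ih =>
    cases t with
    | var x => simp at h
    | func f ts =>
      obtain ⟨j, rfl, hj⟩ := exists_fin_of_subtermAt_cons h
      simpa using ih hj

theorem replaceAt_subst {t u : L.Term V} {p : List ℕ} (σ : V → L.Term V) (s : L.Term V)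
    (h : subtermAt t p = some u) :
    (replaceAt t p s).subst σ = replaceAt (t.subst σ) p (s.subst σ) := by
  induction p generalizing t with
  | nil => simp
  | cons i p ih =>
    cases t with
    | var x => simp at h
    | func f ts =>
      obtain ⟨j, rfl, hj⟩ := exists_fin_of_subtermAt_cons h
      simp only [replaceAt_func_fin, Term.subst, Term.func.injEq, heq_eq_eq, true_and]
      funext k
      by_cases hk : k = j
      · subst hk; simp [ih hj]
      · simp [hk]

theorem subst_subst (t : L.Term V) (σ τ : V → L.Term V) :
    (t.subst σ).subst τ = t.subst fun x => (σ x).subst τ := by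
  induction t with
  | var x => rfl
  | func f ts ih => simp [Term.subst, ih]

theorem subst_var (t : L.Term V) : t.subst .var = t := by
  induction t with
  | var x => rfl
  | func f ts ih => simp [Term.subst, ih]

theorem relabel_subst (t : L.Term V) (g : V → V) (σ : V → L.Term V) :
    (t.relabel g).subst σ = t.subst fun x => σ (g x) := by
  induction t with
  | var x => rfl
  | func f ts ih => simp [Term.subst, ih]

theorem mem_varsOf_var {x y : V} : x ∈ varsOf (.var y : L.Term V) ↔ x = y := by
  constructor
  · rintro ⟨p, hp⟩
    cases p with
    | nil => simp at hp; exact hp.symm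
    | cons i p => simp at hp
  · rintro rfl
    exact ⟨[], by simp⟩

theorem mem_varsOf_func {n : ℕ} {f : L.Functions n} {ts : Fin n → L.Term V} {x : V} :
    x ∈ varsOf (.func f ts) ↔ ∃ i, x ∈ varsOf (ts i) := by
  constructor
  · rintro ⟨p, hp⟩
    cases p with
    | nil => simp at hp
    | cons i p =>
      obtain ⟨j, _, hj⟩ := exists_fin_of_subtermAt_cons hp
      exact ⟨j, p, hj⟩
  · rintro ⟨i, p, hp⟩
    exact ⟨i :: p, by simpa using hp⟩

theorem varsOf_subset_of_subtermAt {t u : L.Term V} {p : List ℕ} (h : subtermAt t p = some u) :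
    varsOf u ⊆ varsOf t := by
  rintro x ⟨q, hq⟩
  exact ⟨p ++ q, by rw [subtermAt_append q h, hq]⟩

theorem finite_varsOf (t : L.Term V) : (varsOf t).Finite := by
  induction t with
  | var y => exact (Set.finite_singleton y).subset fun x hx => mem_varsOf_var.1 hx
  | func f ts ih =>
    exact (Set.finite_iUnion ih).subset fun x hx => Set.mem_iUnion.2 (mem_varsOf_func.1 hx)

theorem subst_eq_subst_iff {t : L.Term V} {σ τ : V → L.Term V} :
    t.subst σ = t.subst τ ↔ ∀ x ∈ varsOf t, σ x = τ x := by
  induction t with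
  | var y => simp [mem_varsOf_var, Term.subst]
  | func f ts ih =>
    simp only [Term.subst, Term.func.injEq, heq_eq_eq, true_and, funext_iff, ih, mem_varsOf_func]
    exact ⟨fun h x ⟨i, hi⟩ => h i x hi, fun h i x hi => h x ⟨i, hi⟩⟩

theorem subtermAt_relabel (g : V → V) (t : L.Term V) (p : List ℕ) :
    subtermAt (t.relabel g) p = (subtermAt t p).map (Term.relabel g) := by
  induction p generalizing t with
  | nil => simp
  | cons i p ih =>
    cases t with
    | var x => simp
    | func f ts =>
      simp only [Term.relabel, subtermAt_func_cons]
      split_ifs with h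
      · exact ih _
      · rfl

theorem subtermAt_relabel_eq_var {g : V → V} {t : L.Term V} {p : List ℕ} {y : V}
    (h : subtermAt (t.relabel g) p = some (.var y)) :
    ∃ x, subtermAt t p = some (.var x) ∧ g x = y := by
  rw [subtermAt_relabel, Option.map_eq_some_iff] at h
  obtain ⟨s, hs, hy⟩ := h
  cases s with
  | var x => exact ⟨x, hs, by simpa using hy⟩
  | func f ts => simp at hy

theorem mem_varsOf_relabel {g : V → V} {t : L.Term V} {y : V} (h : y ∈ varsOf (t.relabel g)) :
    ∃ x ∈ varsOf t, g x = y := by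
  obtain ⟨p, hp⟩ := h
  obtain ⟨x, hx, hy⟩ := subtermAt_relabel_eq_var hp
  exact ⟨x, ⟨p, hx⟩, hy⟩

theorem LinearTerm.relabel {t : L.Term V} (h : LinearTerm t) {g : V → V}
    (hg : Function.Injective g) : LinearTerm (t.relabel g) := by
  intro y p q hp hq
  obtain ⟨x, hx, rfl⟩ := subtermAt_relabel_eq_var hp
  obtain ⟨x', hx', h'⟩ := subtermAt_relabel_eq_var hq
  exact h x p q hx (hg h' ▸ hx')

theorem LinearTerm.of_subtermAt {t u : L.Term V} (h : LinearTerm t) {p : List ℕ}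
    (hp : subtermAt t p = some u) : LinearTerm u := by
  intro x q r hq hr
  exact List.append_cancel_left
    (h x (p ++ q) (p ++ r) (by rw [subtermAt_append q hp, hq]) (by rw [subtermAt_append r hp, hr]))

theorem LinearTerm.arg {n : ℕ} {f : L.Functions n} {ts : Fin n → L.Term V}
    (h : LinearTerm (.func f ts)) (i : Fin n) : LinearTerm (ts i) :=
  h.of_subtermAt (p := [(i : ℕ)]) (by simp)

theorem LinearTerm.arg_unique {n : ℕ} {f : L.Functions n} {ts : Fin n → L.Term V}
    (h : LinearTerm (.func f ts)) {i j : Fin n} {x : V} (hi : x ∈ varsOf (ts i))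
    (hj : x ∈ varsOf (ts j)) : i = j := by
  obtain ⟨p, hp⟩ := hi
  obtain ⟨q, hq⟩ := hj
  have := h x (i :: p) (j :: q) (by simpa using hp) (by simpa using hq)
  simp only [List.cons.injEq, Fin.val_inj] at this
  exact this.1

open Classical in
theorem subst_update_of_notMem {t : L.Term V} {x : V} (hx : x ∉ varsOf t) (σ : V → L.Term V)
    (v : L.Term V) : t.subst (Function.update σ x v) = t.subst σ := by
  rw [subst_eq_subst_iff]
  intro y hy
  rw [Function.update_of_ne]
  rintro rfl
  exact hx hy

open Classical in
/-- In an instance of a linear term, replacing the value of one variable is the same as changing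
the substitution. -/
theorem LinearTerm.replaceAt_subst {t : L.Term V} (ht : LinearTerm t) {p : List ℕ} {x : V}
    (hp : subtermAt t p = some (.var x)) (σ : V → L.Term V) (v : L.Term V) :
    replaceAt (t.subst σ) p v = t.subst (Function.update σ x v) := by
  induction p generalizing t with
  | nil => simp at hp; simp [hp, Term.subst]
  | cons i p ih =>
    cases t with
    | var y => simp at hp
    | func f ts =>
      obtain ⟨j, rfl, hj⟩ := exists_fin_of_subtermAt_cons hp
      simp only [Term.subst, replaceAt_func_fin, Term.func.injEq, heq_eq_eq, true_and]
      funext k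
      by_cases hk : k = j
      · subst hk; simp [ih (ht.arg k) hj]
      · rw [Function.update_of_ne hk, subst_update_of_notMem]
        exact fun hx => hk (ht.arg_unique hx ⟨p, hj⟩)

/-- A position in an instance of `l` is a function position of `l`, or it lies in the part
introduced by the substitution. -/
theorem subtermAt_subst_cases {l u : L.Term V} {σ : V → L.Term V} {p : List ℕ}
    (h : subtermAt (l.subst σ) p = some u) :
    (∃ s, subtermAt l p = some s ∧ ¬ IsVar s ∧ s.subst σ = u) ∨
      ∃ p₁ p₂ x, p = p₁ ++ p₂ ∧ subtermAt l p₁ = some (.var x) ∧ subtermAt (σ x) p₂ = some u := by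
  induction p generalizing l with
  | nil =>
    cases l with
    | var x => exact .inr ⟨[], [], x, rfl, by simp, h⟩
    | func f ts => exact .inl ⟨_, subtermAt_nil _, by simp [IsVar], by simpa using h⟩
  | cons i p ih =>
    cases l with
    | var x => exact .inr ⟨[], i :: p, x, rfl, by simp, h⟩
    | func f ts =>
      obtain ⟨j, rfl, hj⟩ := exists_fin_of_subtermAt_cons h
      rcases ih hj with ⟨s, h₁, h₂, h₃⟩ | ⟨p₁, p₂, x, rfl, h₁, h₂⟩
      · exact .inl ⟨s, by simpa using h₁, h₂, h₃⟩
      · exact .inr ⟨j :: p₁, p₂, x, rfl, by simpa using h₁, h₂⟩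

end Terms

/-! ### Unification of linear terms, renaming apart -/

section Unification

open FirstOrder.Language

variable {L : FirstOrder.Language.{u, v}} {V : Type w}

open Classical in
/-- Unifiable linear terms without common variables have a most general unifier. By linearity the
unifiers of the arguments act on pairwise disjoint sets of variables, so that they can simply be
put together. -/
theorem exists_idempotent_mgu {s t : L.Term V} (hs : LinearTerm s) (ht : LinearTerm t)
    (hd : Disjoint (varsOf s) (varsOf t)) (h : ∃ τ, IsUnifier τ s t) :
    ∃ μ : V → L.Term V, IsUnifier μ s t ∧
      ∀ τ, IsUnifier τ s t → ∀ x, τ x = (μ x).subst τ := by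
  have bind : ∀ (x : V) (t : L.Term V), x ∉ varsOf t →
      ∃ μ : V → L.Term V, IsUnifier μ (.var x) t ∧
        ∀ τ, IsUnifier τ (.var x) t → ∀ y, τ y = (μ y).subst τ := by
    intro x t hx
    refine ⟨Function.update .var x t, ?_, fun τ hτ y => ?_⟩
    · rw [IsUnifier, subst_update_of_notMem hx, subst_var]
      simp [Term.subst]
    · by_cases hy : y = x
      · subst hy; simpa [IsUnifier, Term.subst] using hτ
      · simp [hy, Term.subst]
  induction s generalizing t with
  | var x => exact bind x t fun hx => Set.disjoint_left.1 hd (mem_varsOf_var.2 rfl) hx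
  | func f ts ih =>
    cases t with
    | var y =>
      obtain ⟨μ, h₁, h₂⟩ := bind y (.func f ts)
        fun hy => Set.disjoint_left.1 hd hy (mem_varsOf_var.2 rfl)
      exact ⟨μ, Eq.symm h₁, fun τ hτ => h₂ τ (Eq.symm hτ)⟩
    | func g us =>
      obtain ⟨τ, hτ⟩ := h
      have hτ' := hτ
      simp only [IsUnifier, Term.subst] at hτ'
      injection hτ' with h₁ h₂ h₃
      subst h₁
      obtain rfl := eq_of_heq h₂
      have hsub : ∀ τ : V → L.Term V, IsUnifier τ (.func f ts) (.func f us) →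
          ∀ i, IsUnifier τ (ts i) (us i) := by
        intro τ hτ i
        simp only [IsUnifier, Term.subst, Term.func.injEq, heq_eq_eq, true_and] at hτ
        exact congrFun hτ i
      have hd' : ∀ i j, ∀ x ∈ varsOf (ts i), x ∉ varsOf (us j) := fun i j x hi hj =>
        Set.disjoint_left.1 hd (mem_varsOf_func.2 ⟨i, hi⟩) (mem_varsOf_func.2 ⟨j, hj⟩)
      choose μ hμ hμ' using fun i => ih i (hs.arg i) (ht.arg i)
        (Set.disjoint_left.2 (hd' i i)) ⟨τ, hsub τ hτ i⟩
      let P : V → _ → Prop := fun x i => x ∈ varsOf (ts i) ∨ x ∈ varsOf (us i)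
      have huniq : ∀ {x i j}, P x i → P x j → i = j := by
        rintro x i j (hi | hi) (hj | hj)
        · exact hs.arg_unique hi hj
        · exact (hd' _ _ x hi hj).elim
        · exact (hd' _ _ x hj hi).elim
        · exact ht.arg_unique hi hj
      let ν : V → L.Term V := fun x => if h : ∃ i, P x i then μ h.choose x else .var x
      have hν : ∀ {x i}, P x i → ν x = μ i x := by
        intro x i hi
        have hex : ∃ i, P x i := ⟨i, hi⟩
        simp only [ν, dif_pos hex, huniq hex.choose_spec hi]
      refine ⟨ν, ?_, fun τ hτ x => ?_⟩
      · simp only [IsUnifier, Term.subst, Term.func.injEq, heq_eq_eq, true_and]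
        funext i
        rw [subst_eq_subst_iff.2 fun x hx => hν (.inl hx),
          subst_eq_subst_iff.2 fun x hx => hν (.inr hx)]
        exact hμ i
      · by_cases hex : ∃ i, P x i
        · obtain ⟨i, hi⟩ := hex
          rw [hν hi]
          exact hμ' i τ (hsub τ hτ i) x
        · simp [ν, dif_neg hex, Term.subst]

open Classical in
theorem exists_perm_avoiding [Infinite V] (F G : Finset V) :
    ∃ π : Equiv.Perm V, ∀ x ∈ F, π x ∉ G := by
  induction F using Finset.induction_on with
  | empty => exact ⟨1, by simp⟩
  | insert a F ha ih =>
    obtain ⟨π, hπ⟩ := ih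
    obtain ⟨y, hy⟩ := Infinite.exists_notMem_finset (G ∪ F.image π)
    simp only [Finset.mem_union, Finset.mem_image, not_or, not_exists, not_and] at hy
    refine ⟨π.trans (Equiv.swap (π a) y), fun x hx => ?_⟩
    rcases Finset.mem_insert.1 hx with rfl | hx
    · simpa using hy.1
    · have hne : π x ≠ π a := fun h => ha (π.injective h ▸ hx)
      rw [Equiv.trans_apply, Equiv.swap_apply_of_ne_of_ne hne (hy.2 x hx)]
      exact hπ x hx

end Unification

/-! ### Rewrite sequences along rules -/

section Steps

open FirstOrder.Language

variable {L : FirstOrder.Language.{u, v}} {V : Type w} {R : TRS L V}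

theorem Rule.Step.subst {ρ : Rule L V} {s t : L.Term V} (h : ρ.Step s t) (δ : V → L.Term V) :
    ρ.Step (s.subst δ) (t.subst δ) := by
  obtain ⟨p, σ, hs, rfl⟩ := h
  refine ⟨p, fun x => (σ x).subst δ, ?_, ?_⟩
  · rw [subtermAt_subst δ hs, subst_subst]
  · rw [replaceAt_subst δ _ hs, subst_subst]

theorem Rule.Step.arg {ρ : Rule L V} {n : ℕ} (f : L.Functions n) (ts : Fin n → L.Term V)
    (i : Fin n) {s t : L.Term V} (h : ρ.Step s t) :
    ρ.Step (.func f (Function.update ts i s)) (.func f (Function.update ts i t)) := by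
  obtain ⟨p, σ, hs, rfl⟩ := h
  exact ⟨i :: p, σ, by simpa using hs, by simp⟩

theorem StepsAlong.subst {γs : List R.rules} {s t : L.Term V} (h : StepsAlong γs s t)
    (δ : V → L.Term V) : StepsAlong γs (s.subst δ) (t.subst δ) := by
  induction γs generalizing s with
  | nil => exact congrArg (Term.subst · δ) h
  | cons γ γs ih => obtain ⟨s', h₁, h₂⟩ := h; exact ⟨s'.subst δ, h₁.subst δ, ih h₂⟩

theorem StepsAlong.arg {n : ℕ} (f : L.Functions n) (ts : Fin n → L.Term V) (i : Fin n)
    {γs : List R.rules} {s t : L.Term V} (h : StepsAlong γs s t) :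
    StepsAlong γs (.func f (Function.update ts i s)) (.func f (Function.update ts i t)) := by
  induction γs generalizing s with
  | nil => cases h; rfl
  | cons γ γs ih => obtain ⟨s', h₁, h₂⟩ := h; exact ⟨_, h₁.arg f ts i, ih h₂⟩

theorem StepsAlong.exists_of_append {γs δs : List R.rules} {s t : L.Term V}
    (h : StepsAlong (γs ++ δs) s t) : ∃ s', StepsAlong γs s s' ∧ StepsAlong δs s' t := by
  induction γs generalizing s with
  | nil => exact ⟨s, rfl, h⟩
  | cons γ γs ih =>
    obtain ⟨s₁, h₁, h₂⟩ := h
    obtain ⟨s', h₃, h₄⟩ := ih h₂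
    exact ⟨s', ⟨s₁, h₁, h₃⟩, h₄⟩

end Steps

/-! ### The constraints describing decreasing diagrams -/

section Constraints

open PrecConstraint

variable {I : Type u} {gtR geR : I → I → Prop}

theorem PrecConstraint.holds_disj {φs : List (PrecConstraint I)} :
    (disj φs).Holds gtR geR ↔ ∃ φ ∈ φs, φ.Holds gtR geR := by
  induction φs with
  | nil => simp [disj, Holds]
  | cons φ φs ih => simpa [disj, Holds] using or_congr_right ih

theorem PrecConstraint.holds_conj {φs : List (PrecConstraint I)} :
    (conj φs).Holds gtR geR ↔ ∀ φ ∈ φs, φ.Holds gtR geR := by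
  induction φs with
  | nil => simp [conj, Holds]
  | cons φ φs ih => simpa [conj, Holds] using and_congr_right fun _ => ih

theorem Phi_nil_holds (α β : I) : (Phi α β []).Holds gtR geR := by
  simp [Phi, Psi, holds_disj, holds_conj, Holds]

theorem Phi_singleton_holds {α β γ : I} (h : geR β γ) : (Phi α β [γ]).Holds gtR geR := by
  rw [Phi, holds_disj]
  refine ⟨_, List.mem_map_of_mem (List.mem_range.2 (Nat.succ_pos _)), ?_⟩
  simp [Psi, holds_conj, Holds, h]

/-- The constraint `Φ^α_β(γs)` splits `γs` as one side of a decreasing diagram. -/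
theorem exists_append_of_Phi_holds {α β : I} {γs : List I} (h : (Phi α β γs).Holds gtR geR) :
    ∃ γs₁ γs₂ γs₃, γs = γs₁ ++ (γs₂ ++ γs₃) ∧ (∀ γ ∈ γs₁, gtR α γ) ∧
      (γs₂ = [] ∨ ∃ γ, γs₂ = [γ] ∧ geR β γ) ∧ ∀ γ ∈ γs₃, gtR α γ ∨ gtR β γ := by
  rw [Phi, holds_disj] at h
  obtain ⟨φ, hφ, h⟩ := h
  obtain ⟨i, -, rfl⟩ := List.mem_map.1 hφ
  obtain ⟨h₁, h₂⟩ := h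
  rw [holds_conj] at h₁
  replace h₁ : ∀ γ ∈ γs.take i, gtR α γ := fun γ hγ => h₁ _ (List.mem_map_of_mem hγ)
  have happ := List.take_append_drop i γs
  unfold Psi at h₂
  split at h₂
  · next hd => exact ⟨γs.take i, [], [], by simpa [hd] using happ.symm, h₁, .inl rfl, by simp⟩
  · next γ rest hd =>
    obtain ⟨h₃, h₄⟩ := h₂
    rw [holds_conj] at h₄
    exact ⟨γs.take i, [γ], rest, by simpa [hd] using happ.symm, h₁, .inr ⟨γ, rfl, h₃⟩,
      fun δ hδ => h₄ _ (List.mem_map_of_mem hδ)⟩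

end Constraints

/-! ### Local peaks of linear systems -/

section Peaks

open FirstOrder.Language

variable {L : FirstOrder.Language.{u, v}} {V : Type w} {R : TRS L V}

/-- The terms `t` and `u` obtained from a common term by steps with the rules `α` and `β`
can be joined by a decreasing diagram. -/
def DecreasinglyJoinable (gtR geR : R.rules → R.rules → Prop) (α β : R.rules)
    (t u : L.Term V) : Prop :=
  ∃ γs δs w, StepsAlong γs t w ∧ StepsAlong δs u w ∧
    (Phi α β γs).Holds gtR geR ∧ (Phi β α δs).Holds gtR geR

variable {gtR geR : R.rules → R.rules → Prop} {α β : R.rules}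

theorem DecreasinglyJoinable.symm {t u : L.Term V} (h : DecreasinglyJoinable gtR geR α β t u) :
    DecreasinglyJoinable gtR geR β α u t := by
  obtain ⟨γs, δs, w, h₁, h₂, h₃, h₄⟩ := h
  exact ⟨δs, γs, w, h₂, h₁, h₄, h₃⟩

theorem DecreasinglyJoinable.refl (t : L.Term V) : DecreasinglyJoinable gtR geR α β t t :=
  ⟨[], [], t, rfl, rfl, Phi_nil_holds _ _, Phi_nil_holds _ _⟩

theorem DecreasinglyJoinable.subst {t u : L.Term V} (h : DecreasinglyJoinable gtR geR α β t u)
    (δ : V → L.Term V) : DecreasinglyJoinable gtR geR α β (t.subst δ) (u.subst δ) := by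
  obtain ⟨γs, δs, w, h₁, h₂, h₃, h₄⟩ := h
  exact ⟨γs, δs, _, h₁.subst δ, h₂.subst δ, h₃, h₄⟩

theorem DecreasinglyJoinable.arg {n : ℕ} (f : L.Functions n) (ts : Fin n → L.Term V) (i : Fin n)
    {t u : L.Term V} (h : DecreasinglyJoinable gtR geR α β t u) :
    DecreasinglyJoinable gtR geR α β (.func f (Function.update ts i t))
      (.func f (Function.update ts i u)) := by
  obtain ⟨γs, δs, w, h₁, h₂, h₃, h₄⟩ := h
  exact ⟨γs, δs, _, h₁.arg f ts i, h₂.arg f ts i, h₃, h₄⟩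

theorem decreasinglyJoinable_of_steps (hrefl : ∀ γ, geR γ γ) {t u w : L.Term V}
    (ht : β.1.Step t w) (hu : α.1.Step u w) : DecreasinglyJoinable gtR geR α β t u :=
  ⟨[β], [α], w, ⟨w, ht, rfl⟩, ⟨w, hu, rfl⟩, Phi_singleton_holds (hrefl β),
    Phi_singleton_holds (hrefl α)⟩

open Classical in
/-- A step with `α` inside the substitution part of a `β`-redex commutes with the `β`-step. -/
theorem decreasinglyJoinable_of_variable_overlap (hlin : R.Linear) (hrefl : ∀ γ, geR γ γ)
    {σ τ : V → L.Term V} {p₁ p₂ : List ℕ} {x : V} (hx : subtermAt β.1.lhs p₁ = some (.var x))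
    (hp : subtermAt (τ x) p₂ = some (α.1.lhs.subst σ)) :
    DecreasinglyJoinable gtR geR α β
      (replaceAt (β.1.lhs.subst τ) (p₁ ++ p₂) (α.1.rhs.subst σ)) (β.1.rhs.subst τ) := by
  have hsub := subtermAt_subst τ hx
  simp only [Term.subst] at hsub
  rw [replaceAt_append p₂ _ hsub, (hlin β.1 β.2).1.replaceAt_subst hx]
  have hstep : β.1.Step
      (β.1.lhs.subst (Function.update τ x (replaceAt (τ x) p₂ (α.1.rhs.subst σ))))
      (β.1.rhs.subst (Function.update τ x (replaceAt (τ x) p₂ (α.1.rhs.subst σ)))) :=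
    ⟨[], _, subtermAt_nil _, (replaceAt_nil _ _).symm⟩
  by_cases hr : x ∈ varsOf β.1.rhs
  · obtain ⟨q, hq⟩ := hr
    have hsub' := subtermAt_subst τ hq
    simp only [Term.subst] at hsub'
    refine decreasinglyJoinable_of_steps hrefl hstep ⟨q ++ p₂, σ, ?_, ?_⟩
    · rw [subtermAt_append p₂ hsub', hp]
    · rw [replaceAt_append p₂ _ hsub', (hlin β.1 β.2).2.replaceAt_subst hq]
  · -- The step with `β` erases the redex of `α`.
    rw [subst_update_of_notMem hr] at hstep
    exact ⟨[β], [], _, ⟨_, hstep, rfl⟩, rfl, Phi_singleton_holds (hrefl β), Phi_nil_holds _ _⟩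

open Classical in
/-- A step with `α` at a function position of the left-hand side of a `β`-redex: after renaming
`α` apart from `β` the peak is an instance of a critical peak, or, for variants at the root, it
is trivial. -/
theorem decreasinglyJoinable_of_function_overlap [Infinite V] (hlin : R.Linear) {k : ℕ}
    (hRL : (RL k R).Holds gtR geR) {σ τ : V → L.Term V} {p : List ℕ} {s : L.Term V}
    (hs : subtermAt β.1.lhs p = some s) (hvar : ¬ IsVar s)
    (heq : s.subst τ = α.1.lhs.subst σ) :
    DecreasinglyJoinable gtR geR α β
      (replaceAt (β.1.lhs.subst τ) p (α.1.rhs.subst σ)) (β.1.rhs.subst τ) := by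
  have hfin : ∀ ρ : Rule L V, ρ.vars.Finite := fun ρ =>
    (finite_varsOf ρ.lhs).union (finite_varsOf ρ.rhs)
  obtain ⟨π, hπ⟩ := exists_perm_avoiding (hfin α.1).toFinset (hfin β.1).toFinset
  simp only [Set.Finite.mem_toFinset] at hπ
  let ρ : Rule L V := ⟨α.1.lhs.relabel π, α.1.rhs.relabel π⟩
  have hdisj : Disjoint ρ.vars β.1.vars := by
    rw [Set.disjoint_left]
    rintro y (hy | hy) <;> obtain ⟨x, hx, rfl⟩ := mem_varsOf_relabel hy
    · exact hπ x (.inl hx)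
    · exact hπ x (.inr hx)
  -- The substitution acting as `τ` on the variables of `β` and as `σ` on those of the copy of `α`.
  let ξ : V → L.Term V := fun x => if x ∈ β.1.vars then τ x else σ (π.symm x)
  have hξβ : ∀ t : L.Term V, varsOf t ⊆ β.1.vars → t.subst ξ = t.subst τ := fun t ht =>
    subst_eq_subst_iff.2 fun x hx => if_pos (ht hx)
  have hξα : ∀ t : L.Term V, varsOf t ⊆ α.1.vars → (t.relabel π).subst ξ = t.subst σ := by
    intro t ht
    rw [relabel_subst]
    refine subst_eq_subst_iff.2 fun x hx => ?_
    simp only [ξ, if_neg (hπ x (ht hx)), Equiv.symm_apply_apply]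
  have hll : ρ.lhs.subst ξ = α.1.lhs.subst σ := hξα _ Set.subset_union_left
  have hlr : ρ.rhs.subst ξ = α.1.rhs.subst σ := hξα _ Set.subset_union_right
  have hrl : β.1.lhs.subst ξ = β.1.lhs.subst τ := hξβ _ Set.subset_union_left
  have hrr : β.1.rhs.subst ξ = β.1.rhs.subst τ := hξβ _ Set.subset_union_right
  have hsβ : varsOf s ⊆ β.1.vars :=
    (varsOf_subset_of_subtermAt hs).trans Set.subset_union_left
  have hunif : IsUnifier ξ ρ.lhs s := by rw [IsUnifier, hll, hξβ s hsβ, heq]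
  rw [← hlr, ← hrl, ← hrr]
  -- Variants at the root form no overlap; there both steps have the same result.
  by_cases hv : p = [] ∧ IsVariant ρ β.1
  · obtain ⟨rfl, π', hl, hr⟩ := hv
    obtain rfl : β.1.lhs = s := by simpa using hs
    rw [IsUnifier, hl, relabel_subst ρ.lhs π', subst_eq_subst_iff] at hunif
    have hsub : varsOf ρ.rhs ⊆ varsOf ρ.lhs := by
      intro y hy
      obtain ⟨x, hx, rfl⟩ := mem_varsOf_relabel hy
      obtain ⟨q, hq⟩ := R.vars_subset _ α.2 hx
      exact ⟨q, by simp [ρ, subtermAt_relabel, hq]⟩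
    rw [replaceAt_nil, hr, relabel_subst ρ.rhs π',
      subst_eq_subst_iff.2 fun x hx => hunif x (hsub hx)]
    exact .refl _
  · obtain ⟨μ, hμ, hμ'⟩ := exists_idempotent_mgu
      ((hlin α.1 α.2).1.relabel π.injective) ((hlin β.1 β.2).1.of_subtermAt hs)
      (hdisj.mono Set.subset_union_left hsβ) ⟨ξ, hunif⟩
    let o : Overlap R :=
      { α := α, β := β, inner := ρ, outer := β.1
        inner_variant := ⟨π, rfl, rfl⟩
        outer_variant := ⟨1, (Term.relabel_id _).symm, (Term.relabel_id _).symm⟩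
        disjoint_vars := hdisj
        pos := p, sub := s, sub_eq := hs, sub_not_var := hvar, mgu := μ
        isMGU := ⟨hμ, fun τ hτ => ⟨τ, hμ' τ hτ⟩⟩
        not_variants_of_root := fun hp hv' => hv ⟨hp, hv'⟩ }
    obtain ⟨⟨J, ⟨_, _, w, h₁, h₂⟩, _⟩, h₃, h₄⟩ := hRL o
    have hξ : ∀ t : L.Term V, (t.subst μ).subst ξ = t.subst ξ := fun t => by
      rw [subst_subst]
      exact subst_eq_subst_iff.2 fun x _ => (hμ' ξ hunif x).symm
    have hjoin : DecreasinglyJoinable gtR geR α β o.left o.right :=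
      ⟨J.1, J.2, w, h₁, h₂, h₃, h₄⟩
    have hinst : DecreasinglyJoinable gtR geR α β
        (((replaceAt β.1.lhs p ρ.rhs).subst μ).subst ξ) ((β.1.rhs.subst μ).subst ξ) :=
      hjoin.subst ξ
    rwa [hξ, hξ, replaceAt_subst ξ _ hs] at hinst

variable [Infinite V] {k : ℕ}

theorem decreasinglyJoinable_of_nested (hlin : R.Linear) (hrefl : ∀ γ, geR γ γ)
    (hRL : (RL k R).Holds gtR geR) {σ τ : V → L.Term V} {p : List ℕ}
    (hp : subtermAt (β.1.lhs.subst τ) p = some (α.1.lhs.subst σ)) :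
    DecreasinglyJoinable gtR geR α β
      (replaceAt (β.1.lhs.subst τ) p (α.1.rhs.subst σ)) (β.1.rhs.subst τ) := by
  rcases subtermAt_subst_cases hp with ⟨s, hs, hvar, heq⟩ | ⟨p₁, p₂, x, rfl, hx, hp₂⟩
  · exact decreasinglyJoinable_of_function_overlap hlin hRL hs hvar heq
  · exact decreasinglyJoinable_of_variable_overlap hlin hrefl hx hp₂

/-- The critical pair lemma for decreasing diagrams: all local peaks are decreasing. -/
theorem decreasinglyJoinable_of_peak (hlin : R.Linear) (hrefl : ∀ γ, geR γ γ)
    (hRL : (RL k R).Holds gtR geR) {σ τ : V → L.Term V} {s : L.Term V} {p q : List ℕ}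
    (hp : subtermAt s p = some (α.1.lhs.subst σ)) (hq : subtermAt s q = some (β.1.lhs.subst τ)) :
    DecreasinglyJoinable gtR geR α β
      (replaceAt s p (α.1.rhs.subst σ)) (replaceAt s q (β.1.rhs.subst τ)) := by
  induction p generalizing s q with
  | nil =>
    obtain rfl : s = α.1.lhs.subst σ := by simpa using hp
    rw [replaceAt_nil]
    exact (decreasinglyJoinable_of_nested hlin hrefl hRL hq).symm
  | cons i p ih =>
    cases q with
    | nil =>
      obtain rfl : s = β.1.lhs.subst τ := by simpa using hq
      rw [replaceAt_nil]
      exact decreasinglyJoinable_of_nested hlin hrefl hRL hp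
    | cons j q =>
      cases s with
      | var x => simp at hp
      | func f ts =>
        obtain ⟨i, rfl, hi⟩ := exists_fin_of_subtermAt_cons hp
        obtain ⟨j, rfl, hj⟩ := exists_fin_of_subtermAt_cons hq
        rw [replaceAt_func_fin, replaceAt_func_fin]
        by_cases hij : i = j
        · subst hij
          exact (ih hi hj).arg f ts i
        · refine decreasinglyJoinable_of_steps hrefl
            (w := .func f (Function.update (Function.update ts i
              (replaceAt (ts i) p (α.1.rhs.subst σ))) j (replaceAt (ts j) q (β.1.rhs.subst τ))))
            ⟨j :: q, τ, ?_, ?_⟩ ⟨i :: p, σ, ?_, ?_⟩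
          · simpa [Function.update_of_ne (Ne.symm hij)] using hj
          · simp [Function.update_of_ne (Ne.symm hij)]
          · simpa [Function.update_of_ne hij] using hi
          · simp [Function.update_of_ne hij, Function.update_comm hij]

end Peaks

/-! ### Labelling steps by the rank of their rule -/

section Labelling

open Relation FirstOrder.Language

variable {L : FirstOrder.Language.{u, v}} {V : Type w} {R : TRS L V}

/-- The rewrite steps with rules of rank at most `κ`. -/
def rankedStep {ι : Type*} [LE ι] (rk : R.rules → ι) (κ : ι) (s t : L.Term V) : Prop :=
  ∃ γ : R.rules, rk γ ≤ κ ∧ γ.1.Step s t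

variable {ι : Type*} [LinearOrder ι] {rk : R.rules → ι}

theorem StepsAlong.reflTransGen_below {κ : ι} {γs : List R.rules} {s t : L.Term V}
    (h : StepsAlong γs s t) (hγ : ∀ γ ∈ γs, rk γ < κ) :
    ReflTransGen (below (rankedStep rk) κ) s t := by
  induction γs generalizing s with
  | nil => cases h; exact .refl
  | cons γ γs ih =>
    obtain ⟨s', h₁, h₂⟩ := h
    exact .head ⟨rk γ, hγ γ (by simp), γ, le_rfl, h₁⟩
      (ih h₂ fun δ hδ => hγ δ (List.mem_cons_of_mem _ hδ))

variable {gtR geR : R.rules → R.rules → Prop}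

/-- One side of a decreasing diagram, expressed by ranks. -/
theorem StepsAlong.decreasing_of_Phi_holds (hgt : ∀ a b, gtR a b → rk b < rk a)
    (hge : ∀ a b, geR a b → rk b ≤ rk a) {α β : R.rules} {κ l : ι} (hα : rk α ≤ κ)
    (hβ : rk β ≤ l) {γs : List R.rules} {s t : L.Term V} (h : StepsAlong γs s t)
    (hΦ : (Phi α β γs).Holds gtR geR) :
    ∃ x y, ReflTransGen (below (rankedStep rk) κ) s x ∧ ReflGen (rankedStep rk l) x y ∧
      ReflTransGen (below (rankedStep rk) (max κ l)) y t := by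
  obtain ⟨γs₁, γs₂, γs₃, rfl, h₁, h₂, h₃⟩ := exists_append_of_Phi_holds hΦ
  obtain ⟨x, hx, h⟩ := h.exists_of_append
  obtain ⟨y, hy, h⟩ := h.exists_of_append
  refine ⟨x, y, hx.reflTransGen_below fun γ hγ => (hgt _ _ (h₁ γ hγ)).trans_le hα, ?_,
    h.reflTransGen_below fun γ hγ => ?_⟩
  · rcases h₂ with rfl | ⟨γ, rfl, hγ⟩
    · cases hy; exact .refl
    · obtain ⟨y', hy, rfl⟩ := hy
      exact .single ⟨γ, (hge _ _ hγ).trans hβ, hy⟩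
  · rcases h₃ γ hγ with h | h
    · exact ((hgt _ _ h).trans_le hα).trans_le (le_max_left _ _)
    · exact ((hgt _ _ h).trans_le hβ).trans_le (le_max_right _ _)

theorem isLocallyDecreasing_rankedStep (hgt : ∀ a b, gtR a b → rk b < rk a)
    (hge : ∀ a b, geR a b → rk b ≤ rk a)
    (hpeak : ∀ {α β : R.rules} {s t u : L.Term V}, α.1.Step s t → β.1.Step s u →
      DecreasinglyJoinable gtR geR α β t u) :
    IsLocallyDecreasing (rankedStep rk) where
  mono := fun hl _ _ ⟨γ, hγ, h⟩ => ⟨γ, hγ.trans hl, h⟩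
  peak_lt := by
    rintro l κ hl a b c ⟨α, hα, hab⟩ ⟨β, hβ, hac⟩
    obtain ⟨γs, δs, w, h₁, h₂, h₃, h₄⟩ := hpeak hab hac
    obtain ⟨x, y, hbx, hxy, hyw⟩ := h₁.decreasing_of_Phi_holds hgt hge hα hβ h₃
    obtain ⟨x', y', hcx, hxy', hyw'⟩ := h₂.decreasing_of_Phi_holds hgt hge hβ hα h₄
    rw [max_eq_left hl.le] at hyw
    rw [max_eq_right hl.le] at hyw'
    have hbw : ReflTransGen (below (rankedStep rk) κ) b w := by
      refine (hbx.trans ?_).trans hyw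
      cases hxy with
      | refl => exact .refl
      | single h => exact .single ⟨l, hl, h⟩
    have hy'b : EqvGen (below (rankedStep rk) κ) y' b :=
      .trans _ _ _ (eqvGen_of_reflTransGen hyw') (eqvGen_of_reflTransGen hbw).symm
    cases hxy' with
    | refl =>
      exact .inl (.trans _ _ _ (eqvGen_of_reflTransGen (reflTransGen_below_mono hl.le hcx)) hy'b)
    | single h => exact .inr ⟨x', y', hcx, h, hy'b⟩
  peak_eq := by
    rintro κ a b c ⟨α, hα, hab⟩ ⟨β, hβ, hac⟩
    obtain ⟨γs, δs, w, h₁, h₂, h₃, h₄⟩ := hpeak hab hac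
    obtain ⟨x, y, hbx, hxy, hyw⟩ := h₁.decreasing_of_Phi_holds hgt hge hα hβ h₃
    obtain ⟨x', y', hcx, hxy', hyw'⟩ := h₂.decreasing_of_Phi_holds hgt hge hβ hα h₄
    rw [max_self] at hyw hyw'
    exact ⟨x, y, x', y', hbx, hxy,
      .trans _ _ _ (eqvGen_of_reflTransGen hyw) (eqvGen_of_reflTransGen hyw').symm, hxy', hcx⟩

end Labelling

/-- A precedence is represented by ordinals: the rank with respect to `>` is strictly monotone for
`>`, and by compatibility it is monotone for `⩾`. -/
theorem PrecConstraint.IsPrecedence.exists_rank {I : Type u} {gtR geR : I → I → Prop}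
    (h : IsPrecedence gtR geR) : ∃ rk : I → Ordinal.{u},
      (∀ a b, gtR a b → rk b < rk a) ∧ ∀ a b, geR a b → rk b ≤ rk a := by
  have : IsWellFounded I fun a b => gtR b a := ⟨h.gt_wf⟩
  refine ⟨IsWellFounded.rank fun a b => gtR b a, fun a b hab => IsWellFounded.rank_lt_of_rel
    (r := fun a b => gtR b a) hab, fun a b hab => ?_⟩
  rw [IsWellFounded.rank_eq (fun a b => gtR b a) b]
  refine Ordinal.iSup_le fun ⟨c, hc⟩ => Order.succ_le_of_lt ?_
  exact IsWellFounded.rank_lt_of_rel (r := fun a b => gtR b a)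
    (h.compat _ _ _ _ hab hc (h.ge_refl c))

end Rewriting

theorem mainTheorem4 {L : FirstOrder.Language} {V : Type*} [Infinite V]
    (R : Rewriting.TRS L V) (hlin : R.Linear)
    (hsat : ∃ k : ℕ, (Rewriting.RL k R).Satisfiable) :
    R.IsConfluent := by
  obtain ⟨k, gtR, geR, hprec, hRL⟩ := hsat
  obtain ⟨rk, hgt, hge⟩ := hprec.exists_rank
  have hdecr := Rewriting.isLocallyDecreasing_rankedStep (rk := rk) hgt hge
    fun {α β s t u} ⟨p, σ, hp, ht⟩ ⟨q, τ, hq, hu⟩ => by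
      subst ht hu
      exact Rewriting.decreasinglyJoinable_of_peak hlin hprec.ge_refl hRL hp hq
  have heq : R.Rewrites = fun s t => ∃ κ, Rewriting.rankedStep rk κ s t := by
    funext s t
    exact propext ⟨fun ⟨ρ, hρ, h⟩ => ⟨rk ⟨ρ, hρ⟩, ⟨ρ, hρ⟩, le_rfl, h⟩,
      fun ⟨_, γ, _, h⟩ => ⟨γ.1, γ.2, h⟩⟩
  rw [Rewriting.TRS.IsConfluent, heq]
  exact hdecr.confluent
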